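/- Let $\mathbb{K}=\mathbb{R}$ or $\mathbb{C}$, let $\Omega$ be a non-empty topological Hausdorff space, let $\mathcal{F}$ be a linear space of continuous functions $\Omega\to\mathbb{K}$ and let $\tau$ be a bornological locally convex Hausdorff topology on $\mathcal{F}$. Denote by $\mathcal{B}$ the family of $\tau$-bounded sets, by $\tau_{\mathrm{p}}$ the topology of pointwise convergence on $\mathcal{F}$, by $\tau_{\mathrm{co}}$ the topology on $\mathcal{F}$ of uniform convergence on compact subsets of $\Omega$, and put $\delta_x(f):=f(x)$ for $x\in\Omega$ and $f\in\mathcal{F}$. For topologies, $\sigma\le\sigma'$ means that $\sigma$ is coarser than $\sigma'$. A *continuous strong complete barrelled linearisation* of $(\mathcal{F},\tau)$ is a triple $(\delta,Y,T)$ of a complete barrelled locally convex Hausdorff space $Y$ over $\mathbb{K}$, a continuous map $\delta\colon\Omega\to Y$ and a topological isomorphism $T$ from $(\mathcal{F},\tau)$ onto the strong dual $Y_b'$ such that $T(f)\circ\delta=f$ for all $f\in\mathcal{F}$. For a locally convex Hausdorff topology $\widetilde\tau$ on $\mathcal{F}$, $(\mathcal{F},\tau)$ satisfies $(\mathrm{BBC})$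 for $\widetilde\tau$ if every $\tau$-bounded set is contained in an absolutely convex $\tau$-bounded $\widetilde\tau$-compact set, and $(\mathrm{CNC})$ for $\widetilde\tau$ if $\tau$ has a $0$-neighbourhood basis of absolutely convex $\widetilde\tau$-closed sets. Let $\mathcal{F}'_{\mathcal{B},\widetilde\tau}$ be the space of all linear functionals on $\mathcal{F}$ whose restriction to each $B\in\mathcal{B}$ is $\widetilde\tau$-continuous, equipped with the topology $\beta$ of uniform convergence on the sets $B\in\mathcal{B}$. Consider the following assertions. (a) $(\mathcal{F},\tau)$ admits a continuous strong complete barrelled linearisation. (b) $(\mathcal{F},\tau)$ satisfies $(\mathrm{BBC})$ and $(\mathrm{CNC})$ for some locally convex Hausdorff topology $\widetilde\tau$ on $\mathcal{F}$ with $\tau_{\mathrm{p}}\le\widetilde\tau$, and every $B\in\mathcal{B}$ is equicontinuous. (c) $(\mathcal{F},\tau)$ satisfies $(\mathrm{BBC})$ and $(\mathrm{CNC})$ for some locally convex Hausdorff topology $\widetilde\tau$ on $\mathcal{F}$ such that $\delta_x\in\mathcal{F}'_{\mathcal{B},\widetilde\tau}$ for all $x\in\Omega$ and the map $\Delta\colon\Omega\to(\mathcal{F}'_{\mathcal{B},\widetilde\tau},\beta)$,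 $\Delta(x):=\delta_x$, is continuous. (d) $(\mathcal{F},\tau)$ satisfies $(\mathrm{BBC})$ and $(\mathrm{CNC})$ for some locally convex Hausdorff topology $\widetilde\tau$ on $\mathcal{F}$ with $\tau_{\mathrm{co}}\le\widetilde\tau$. Then (a)$\Leftrightarrow$(b)$\Leftrightarrow$(c). If $\Omega$ is a $gk_{\mathbb{R}}$-space, that is, if every map from $\Omega$ to a completely regular space whose restriction to each compact subset of $\Omega$ is continuous is itself continuous, then (d)$\Rightarrow$(c). -/

import Mathlib

open scoped ComplexOrder

universe u v w w'

/-! Topologies on a vector space are passed as explicit arguments, since several of them live on the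
same space. The order `t₁ ≤ t₂` on `TopologicalSpace X` means that `t₁` is finer than `t₂`. -/

section Spaces

variable (𝕜 : Type v) [RCLike 𝕜] {X : Type u} [AddCommGroup X] [Module 𝕜 X]

/-- `τ` is a locally convex Hausdorff (vector space) topology on `X`. -/
structure IsLocallyConvexHausdorff (τ : TopologicalSpace X) : Prop where
  isTopologicalAddGroup : @IsTopologicalAddGroup X τ _
  continuousSMul : @ContinuousSMul 𝕜 X _ _ τ
  locallyConvexSpace : @LocallyConvexSpace 𝕜 X _ _ _ _ τ
  t2Space : @T2Space X τ

/-- `B` is a `τ`-bounded subset of `X`. -/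
abbrev IsBoundedFor (τ : TopologicalSpace X) (B : Set X) : Prop :=
  @Bornology.IsVonNBounded 𝕜 X _ _ _ τ B

/-- The topology `τ` is bornological: every absolutely convex set that absorbs all `τ`-bounded sets
is a `τ`-neighbourhood of `0`. -/
def IsBornological (τ : TopologicalSpace X) : Prop :=
  ∀ U : Set X, AbsConvex 𝕜 U → (∀ B : Set X, IsBoundedFor 𝕜 τ B → Absorbs 𝕜 U B) →
    U ∈ @nhds X τ 0

/-- Condition (BBC) of `(X, τ)` for `τ'`: every `τ`-bounded set is contained in an absolutely convex
`τ`-bounded `τ'`-compact set. -/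
def SatisfiesBBC (τ τ' : TopologicalSpace X) : Prop :=
  ∀ B : Set X, IsBoundedFor 𝕜 τ B →
    ∃ K : Set X, B ⊆ K ∧ AbsConvex 𝕜 K ∧ IsBoundedFor 𝕜 τ K ∧ @IsCompact X τ' K

/-- Condition (CNC) of `(X, τ)` for `τ'`: `τ` has a `0`-neighbourhood basis of absolutely convex
`τ'`-closed sets. -/
def SatisfiesCNC (τ τ' : TopologicalSpace X) : Prop :=
  (@nhds X τ 0).HasBasis
    (fun U : Set X => U ∈ @nhds X τ 0 ∧ AbsConvex 𝕜 U ∧ @IsClosed X τ' U) id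

/-- The space of all linear functionals on `X` whose restriction to every `τ`-bounded set is
`τ'`-continuous. -/
def boundedlyContinuousDual (τ τ' : TopologicalSpace X) : Submodule 𝕜 (Module.Dual 𝕜 X) where
  carrier := {φ | ∀ B : Set X, IsBoundedFor 𝕜 τ B → @ContinuousOn X 𝕜 τ' _ φ B}
  zero_mem' := fun _ _ => @continuousOn_const X 𝕜 τ' _ _ _
  add_mem' := fun hφ hψ B hB => by
    let _ := τ'
    exact (hφ B hB).add (hψ B hB)
  smul_mem' := fun c _ hφ B hB => by
    let _ := τ'
    exact (hφ B hB).const_smul c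

/-- The topology `β` on `boundedlyContinuousDual 𝕜 τ τ'` of uniform convergence on the `τ`-bounded
subsets of `X`. -/
@[reducible]
def boundedlyContinuousDualTopology (τ τ' : TopologicalSpace X) :
    TopologicalSpace (boundedlyContinuousDual 𝕜 τ τ') :=
  TopologicalSpace.induced
    (fun φ => UniformOnFun.ofFun {B : Set X | IsBoundedFor 𝕜 τ B} (φ.1 : X → 𝕜)) inferInstance

end Spaces

section FunctionSpaces

variable {𝕜 : Type v} [RCLike 𝕜] {Ω : Type u}

/-- The topology `τ_p` of pointwise convergence on `F`. -/
@[reducible]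
def pointwiseTopology (F : Submodule 𝕜 (Ω → 𝕜)) : TopologicalSpace F :=
  TopologicalSpace.induced (fun f : F => (f.1 : Ω → 𝕜)) Pi.topologicalSpace

/-- The topology `τ_co` on `F` of uniform convergence on the compact subsets of `Ω`. -/
@[reducible]
def compactOpenTopology [TopologicalSpace Ω] (F : Submodule 𝕜 (Ω → 𝕜)) : TopologicalSpace F :=
  TopologicalSpace.induced
    (fun f : F => UniformOnFun.ofFun {K : Set Ω | IsCompact K} (f.1 : Ω → 𝕜)) inferInstance

/-- The point evaluation `δ_x : F → 𝕜`, `δ_x f = f x`. -/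
def pointEvaluation (F : Submodule 𝕜 (Ω → 𝕜)) (x : Ω) : Module.Dual 𝕜 F :=
  (LinearMap.proj x).comp F.subtype

/-- `(δ, Y, T)` is a strong linearisation of `(F, τ)`: `T` is a topological isomorphism from `(F, τ)`
onto the strong dual of `Y` (Mathlib's topology on `StrongDual 𝕜 Y` is that of uniform convergence
on bounded sets) with `T f ∘ δ = f` for all `f` in `F`. -/
structure IsStrongLinearisation (F : Submodule 𝕜 (Ω → 𝕜)) (τ : TopologicalSpace F)
    {Y : Type w} [AddCommGroup Y] [Module 𝕜 Y] [TopologicalSpace Y]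
    (δ : Ω → Y) (T : F ≃ₗ[𝕜] StrongDual 𝕜 Y) : Prop where
  isHomeomorph : @IsHomeomorph F (StrongDual 𝕜 Y) τ _ T
  comp_eq : ∀ f : F, (fun x : Ω => T f (δ x)) = f.1

/-- `(F, τ)` admits a continuous strong complete barrelled linearisation. The uniform structure of
`Y` is the one determined by its vector space topology. -/
def AdmitsContinuousStrongCompleteBarrelledLinearisation [TopologicalSpace Ω]
    (F : Submodule 𝕜 (Ω → 𝕜)) (τ : TopologicalSpace F) : Prop :=
  ∃ (Y : Type (max u v w)) (_ : AddCommGroup Y) (_ : Module 𝕜 Y) (_ : UniformSpace Y)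
    (_ : IsUniformAddGroup Y) (_ : ContinuousSMul 𝕜 Y) (_ : LocallyConvexSpace 𝕜 Y) (_ : T2Space Y)
    (δ : Ω → Y) (T : F ≃ₗ[𝕜] StrongDual 𝕜 Y),
    CompleteSpace Y ∧ BarrelledSpace 𝕜 Y ∧ IsStrongLinearisation F τ δ T ∧ Continuous δ

end FunctionSpaces

/-- `Ω` is a `gk_ℝ`-space: every map from `Ω` to a completely regular space whose restriction to each
compact subset is continuous is continuous. -/
def IsGkRSpace (Ω : Type u) [TopologicalSpace Ω] : Prop :=
  ∀ (Z : Type w') [TopologicalSpace Z] [CompletelyRegularSpace Z] (f : Ω → Z),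
    (∀ K : Set Ω, IsCompact K → ContinuousOn f K) → Continuous f

/-!
The predual of `(X, τ)` is the space `Y = X'_{𝓑, τ'}` with the topology `β`. It is complete because
a uniform limit, on the bounded sets, of linear functionals that are `τ'`-continuous there is again
such a functional.

The evaluation map `X → Y'` is injective by the Hahn–Banach theorem for `τ'`. It is surjective
because a functional on `Y` lies in the bipolar of the image of some bounded set, hence, by (BBC),
of an absolutely convex `τ'`-compact set `K`, whose image in `Y'` is weak-* compact and so equal to
its own bipolar. Under (CNC) the bipolar theorem for `τ'` exhibits every `τ`-neighbourhood of zero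
as containing the polar of a bounded subset of `Y`, and such a polar is a `τ`-neighbourhood of zero
because `τ` is bornological; so `τ` is the strong topology. Finally, a lower semicontinuous
seminorm on the complete space `Y` is bounded on bounded sets (Banach–Mackey). The polar of its
closed unit ball is therefore strongly bounded, that is, `τ`-bounded, and the unit ball, being the
polar of a `τ`-bounded set, is a neighbourhood of zero: `Y` is barrelled.

Conversely, for a linearisation with values in a barrelled space `Y`, the weak-* topology on `Y'`
satisfies (BBC) by the Banach–Steinhaus and Banach–Alaoglu theorems, and (CNC) because polars are
weak-* closed; equicontinuity of bounded subsets of `Y'` passes to `Ω` along `δ`.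
-/

open Topology Filter Bornology
open scoped Pointwise lp

section Polars

variable {𝕜 : Type*} [RCLike 𝕜]

theorem convex_of_convex_real {E : Type*} [AddCommGroup E] [Module 𝕜 E] [Module ℝ E]
    [IsScalarTower ℝ 𝕜 E] {s : Set E} (hs : Convex ℝ s) : Convex 𝕜 s := by
  refine convex_of_nonneg_surjective_algebraMap 𝕜 (fun a ha => ?_) hs
  rw [Set.mem_Ici, RCLike.nonneg_iff] at ha
  exact ⟨RCLike.re a, ha.1, RCLike.conj_eq_iff_re.1 (RCLike.conj_eq_iff_im.2 ha.2)⟩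

theorem locallyConvexSpace_rclike : LocallyConvexSpace 𝕜 𝕜 :=
  LocallyConvexSpace.ofBasisZero 𝕜 𝕜 _ _ Metric.nhds_basis_closedBall
    fun _ _ => convex_of_convex_real (convex_closedBall _ _)

variable {E V W : Type*} [AddCommGroup E] [Module 𝕜 E] [AddCommGroup V] [Module 𝕜 V]
  [AddCommGroup W] [Module 𝕜 W]

theorem isScalarTower_real_compHom :
    letI := Module.compHom E (algebraMap ℝ 𝕜)
    IsScalarTower ℝ 𝕜 E :=
  letI := Module.compHom E (algebraMap ℝ 𝕜)
  ⟨fun r c x => by rw [Algebra.smul_def, mul_smul]; rfl⟩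

theorem absConvex_seminorm_closedBall_zero (p : Seminorm 𝕜 E) (r : ℝ) :
    AbsConvex 𝕜 (p.closedBall 0 r) := by
  let := Module.compHom E (algebraMap ℝ 𝕜)
  have : IsScalarTower ℝ 𝕜 E := isScalarTower_real_compHom
  exact ⟨p.balanced_closedBall_zero r, convex_of_convex_real (p.convex_closedBall 0 r)⟩

theorem absConvex_polar (b : V →ₗ[𝕜] W →ₗ[𝕜] 𝕜) (s : Set V) : AbsConvex 𝕜 (b.polar s) := by
  rw [b.polar_eq_iInter]
  refine AbsConvex.iInter₂ fun v _ => ?_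
  simpa only [Seminorm.closedBall_zero_eq, LinearMap.toSeminorm_apply] using
    absConvex_seminorm_closedBall_zero (b v).toSeminorm 1

theorem absorbs_polar_iff (b : V →ₗ[𝕜] W →ₗ[𝕜] 𝕜) {s : Set V} {t : Set W} :
    Absorbs 𝕜 (b.polar s) t ↔ ∃ C : ℝ, ∀ v ∈ s, ∀ w ∈ t, ‖b v w‖ ≤ C := by
  have inv_smul_mem {c : 𝕜} (hc : 0 < ‖c‖) (w : W) :
      c⁻¹ • w ∈ b.polar s ↔ ∀ v ∈ s, ‖b v w‖ ≤ ‖c‖ := by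
    simp only [b.polar_mem_iff, map_smul, norm_smul, norm_inv, inv_mul_le_one₀ hc]
  rw [absorbs_iff_eventually_cobounded_mapsTo]
  constructor
  · intro h
    obtain ⟨c, hc, hc1⟩ := (h.and (eventually_cobounded_le_norm (1 : ℝ))).exists
    exact ⟨‖c‖, fun v hv w hw => (inv_smul_mem (one_pos.trans_le hc1) w).1 (hc hw) v hv⟩
  · rintro ⟨C, hC⟩
    filter_upwards [eventually_cobounded_le_norm (max C 1)] with c hc w hw
    exact (inv_smul_mem (one_pos.trans_le ((le_max_right C 1).trans hc)) w).2 fun v hv =>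
      (hC v hv w hw).trans ((le_max_left C 1).trans hc)

theorem absorbs_polar_comm (b : V →ₗ[𝕜] W →ₗ[𝕜] 𝕜) {s : Set V} {t : Set W} :
    Absorbs 𝕜 (b.polar s) t ↔ Absorbs 𝕜 (b.flip.polar t) s := by
  rw [absorbs_polar_iff, absorbs_polar_iff]
  simp only [LinearMap.flip_apply]
  exact exists_congr fun C => ⟨fun h w hw v hv => h v hv w hw, fun h v hv w hw => h w hw v hv⟩

section Bipolar

variable [TopologicalSpace E] [IsTopologicalAddGroup E] [ContinuousSMul 𝕜 E]
  [LocallyConvexSpace 𝕜 E]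

theorem exists_strongDual_norm_le_one_of_notMem {s : Set E} (hs : AbsConvex 𝕜 s)
    (hs_closed : IsClosed s) (hs_nonempty : s.Nonempty) {x : E} (hx : x ∉ s) :
    ∃ f : StrongDual 𝕜 E, (∀ a ∈ s, ‖f a‖ ≤ 1) ∧ 1 < ‖f x‖ := by
  let := Module.compHom E (algebraMap ℝ 𝕜)
  have : IsScalarTower ℝ 𝕜 E := isScalarTower_real_compHom
  have : LocallyConvexSpace ℝ E := LocallyConvexSpace.ofBasisZero ℝ E _ _
    (LocallyConvexSpace.convex_basis_zero 𝕜 E) fun _ hi => hi.2.lift ℝ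
  obtain ⟨f, u, hfs, hfx⟩ :=
    RCLike.geometric_hahn_banach_closed_point (𝕜 := 𝕜) (hs.2.lift ℝ) hs_closed hx
  have hu : 0 < u := by simpa using hfs 0 (hs.1.zero_mem hs_nonempty)
  have norm_le : ∀ a ∈ s, ‖f a‖ ≤ u := fun a ha => by
    -- rotating `a` inside the balanced set `s` turns `re (f a)` into `‖f a‖`
    obtain ⟨c, hc, hcf⟩ := RCLike.exists_norm_eq_mul_self (f a)
    have := hfs (c • a) (hs.1.smul_mem hc.le ha)
    rw [map_smul, smul_eq_mul, ← hcf, RCLike.ofReal_re] at this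
    exact this.le
  have norm_smul_f (y : E) : ‖(((u⁻¹ : ℝ) : 𝕜) • f) y‖ = u⁻¹ * ‖f y‖ := by
    rw [smul_apply, norm_smul, RCLike.norm_ofReal, abs_of_pos (inv_pos.2 hu)]
  refine ⟨((u⁻¹ : ℝ) : 𝕜) • f, fun a ha => ?_, ?_⟩
  · rw [norm_smul_f, inv_mul_le_one₀ hu]
    exact norm_le a ha
  · rw [norm_smul_f, ← div_eq_inv_mul, one_lt_div hu]
    exact hfx.trans_le (RCLike.re_le_norm _)

theorem polar_flip_polar_eq_of_isClosed (b : W →ₗ[𝕜] E →ₗ[𝕜] 𝕜)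
    (hb : ∀ f : StrongDual 𝕜 E, ∃ w, ∀ x, b w x = f x) {s : Set E} (hs : AbsConvex 𝕜 s)
    (hs_closed : IsClosed s) (hs_nonempty : s.Nonempty) : b.polar (b.flip.polar s) = s := by
  refine subset_antisymm (fun x hx => ?_) (b.flip.subset_bipolar s)
  by_contra hxs
  obtain ⟨f, hfs, hfx⟩ := exists_strongDual_norm_le_one_of_notMem hs hs_closed hs_nonempty hxs
  obtain ⟨w, hw⟩ := hb f
  have hw_mem : w ∈ b.flip.polar s := fun a ha => by
    rw [LinearMap.flip_apply, hw]
    exact hfs a ha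
  have := hx w hw_mem
  rw [hw] at this
  exact hfx.not_ge this

end Bipolar

end Polars

section PolarTopology

variable {𝕜 : Type*} [RCLike 𝕜] {V X : Type*} [AddCommGroup V] [Module 𝕜 V] [AddCommGroup X]
  [Module 𝕜 X] [TopologicalSpace V] {𝔖 : Set (Set X)}

theorem hasBasis_nhds_zero_polar_of_isInducing {b : V →ₗ[𝕜] X →ₗ[𝕜] 𝕜}
    (h𝔖 : 𝔖.Nonempty) (h𝔖_directed : DirectedOn (· ⊆ ·) 𝔖)
    (h𝔖_smul : ∀ (c : 𝕜), ∀ B ∈ 𝔖, c • B ∈ 𝔖)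
    (hb : IsInducing fun v => UniformOnFun.ofFun 𝔖 (b v)) :
    (𝓝 (0 : V)).HasBasis (· ∈ 𝔖) b.flip.polar := by
  have key := (UniformOnFun.hasBasis_nhds_zero_of_basis 𝔖 h𝔖 h𝔖_directed
    (Metric.nhds_basis_closedBall (x := (0 : 𝕜)))).comap fun v => UniformOnFun.ofFun 𝔖 (b v)
  have nhds_zero : 𝓝 (0 : V) = comap (fun v => UniformOnFun.ofFun 𝔖 (b v)) (𝓝 0) := by
    rw [hb.nhds_eq_comap, map_zero]
    rfl
  rw [nhds_zero]
  refine key.to_hasBasis ?_ fun B hB => ⟨(B, 1), ⟨hB, one_pos⟩, fun v hv x hx => ?_⟩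
  · rintro ⟨B, r⟩ ⟨hB, hr⟩
    refine ⟨((r⁻¹ : ℝ) : 𝕜) • B, h𝔖_smul _ B hB, fun v hv x hx => ?_⟩
    have := hv _ (Set.smul_mem_smul_set hx)
    rw [LinearMap.flip_apply, map_smul, norm_smul, RCLike.norm_ofReal, abs_of_pos (inv_pos.2 hr),
      inv_mul_le_one₀ hr] at this
    exact mem_closedBall_zero_iff.2 this
  · exact mem_closedBall_zero_iff.1 (hv x hx)

theorem isVonNBounded_iff_absorbs_polar {b : V →ₗ[𝕜] X →ₗ[𝕜] 𝕜}
    (hb : (𝓝 (0 : V)).HasBasis (· ∈ 𝔖) b.flip.polar) {A : Set V} :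
    IsVonNBounded 𝕜 A ↔ ∀ B ∈ 𝔖, Absorbs 𝕜 (b.polar A) B := by
  rw [hb.isVonNBounded_iff]
  exact forall₂_congr fun B _ => (absorbs_polar_comm b).symm

end PolarTopology

section StrongDual

variable {𝕜 : Type*} [RCLike 𝕜] {E : Type*} [AddCommGroup E] [Module 𝕜 E] [TopologicalSpace E]

theorem isVonNBounded_smul [ContinuousConstSMul 𝕜 E] {B : Set E} (hB : IsVonNBounded 𝕜 B)
    (c : 𝕜) : IsVonNBounded 𝕜 (c • B) :=
  hB.image (c • ContinuousLinearMap.id 𝕜 E)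

theorem hasBasis_nhds_zero_strongDual_polar [ContinuousConstSMul 𝕜 E] :
    (𝓝 (0 : StrongDual 𝕜 E)).HasBasis (· ∈ {B : Set E | IsVonNBounded 𝕜 B})
      (StrongDual.polar 𝕜) :=
  hasBasis_nhds_zero_polar_of_isInducing (b := topDualPairing 𝕜 E) ⟨∅, isVonNBounded_empty 𝕜 E⟩
    (directedOn_of_sup_mem fun _ _ => IsVonNBounded.union) (fun c _ hB => isVonNBounded_smul hB c)
    ContinuousLinearMap.isUniformEmbedding_toUniformOnFun.isUniformInducing.isInducing

theorem isVonNBounded_strongDual_polar [ContinuousConstSMul 𝕜 E] {U : Set E}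
    (hU : ∀ B : Set E, IsVonNBounded 𝕜 B → Absorbs 𝕜 U B) :
    IsVonNBounded 𝕜 (StrongDual.polar 𝕜 U) :=
  (isVonNBounded_iff_absorbs_polar (b := topDualPairing 𝕜 E)
    hasBasis_nhds_zero_strongDual_polar).2 fun B hB =>
      (hU B hB).mono_left ((topDualPairing 𝕜 E).flip.subset_bipolar U)

end StrongDual

section BanachMackey

variable {𝕜 : Type*} [RCLike 𝕜] {E : Type*} [AddCommGroup E] [Module 𝕜 E]

theorem seminorm_sum_le {ι : Type*} (p : Seminorm 𝕜 E) (s : Finset ι) (f : ι → E) :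
    p (∑ i ∈ s, f i) ≤ ∑ i ∈ s, p (f i) :=
  Finset.le_sum_of_subadditive p (map_zero p).le (map_add_le_add p) s f

theorem polynormableSpace_of_locallyConvexSpace [TopologicalSpace E] [IsTopologicalAddGroup E]
    [ContinuousSMul 𝕜 E] [LocallyConvexSpace 𝕜 E] : PolynormableSpace 𝕜 E := by
  let := Module.compHom E (algebraMap ℝ 𝕜)
  have : IsScalarTower ℝ 𝕜 E := isScalarTower_real_compHom
  have : ContinuousSMul ℝ E := IsScalarTower.continuousSMul 𝕜
  infer_instance

theorem seminorm_tsum_le [TopologicalSpace E] {ι : Type*} {f : ι → E} {p : Seminorm 𝕜 E}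
    (hp : Continuous p) (hf : Summable f) (hpf : Summable fun i => p (f i)) :
    p (∑' i, f i) ≤ ∑' i, p (f i) :=
  le_of_tendsto_of_tendsto' ((hp.tendsto _).comp hf.hasSum) hpf.hasSum
    fun s => seminorm_sum_le p s f

theorem summable_norm_coeFn_lp_one {ι : Type*} (a : ℓ¹(ι, 𝕜)) : Summable fun i => ‖a i‖ := by
  simpa using a.2.summable

theorem exists_seminorm_smul_le [TopologicalSpace E] [PolynormableSpace 𝕜 E]
    {ι : Type*} {x : ι → E} (hx : IsVonNBounded 𝕜 (Set.range x)) {p : Seminorm 𝕜 E}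
    (hp : Continuous p) : ∃ C : NNReal, ∀ (a : ι → 𝕜) i, p (a i • x i) ≤ C * ‖a i‖ := by
  obtain ⟨C, hC0, hC⟩ := ((PolynormableSpace.withSeminorms 𝕜 E).isVonNBounded_iff_seminorm_bounded.1
    hx) ⟨p, hp⟩
  refine ⟨⟨C, hC0.le⟩, fun a i => ?_⟩
  rw [map_smul_eq_mul, mul_comm]
  exact mul_le_mul_of_nonneg_right (hC _ ⟨i, rfl⟩).le (norm_nonneg _)

variable [UniformSpace E] [IsUniformAddGroup E] [PolynormableSpace 𝕜 E]

theorem summable_of_summable_seminorm [CompleteSpace E] {ι : Type*} {f : ι → E}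
    (hf : ∀ p : Seminorm 𝕜 E, Continuous p → Summable fun i => p (f i)) : Summable f := by
  refine summable_iff_vanishing.2 fun U hU => ?_
  obtain ⟨s, r, hr, hsU⟩ := ((PolynormableSpace.withSeminorms 𝕜 E).mem_nhds_iff 0 U).1 hU
  set p : Seminorm 𝕜 E := s.sup Subtype.val
  have hp : Summable fun i => p (f i) := by
    refine Summable.of_nonneg_of_le (fun i => apply_nonneg p _) (fun i => ?_)
      (summable_sum fun q (_ : q ∈ s) => hf q.1 q.2)
    exact Seminorm.finset_sup_apply_le (Finset.sum_nonneg fun q _ => apply_nonneg q.1 _)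
      fun q hq => Finset.single_le_sum (f := fun q => q.1 (f i))
        (fun q _ => apply_nonneg q.1 _) hq
  obtain ⟨t, ht⟩ := summable_iff_vanishing.1 hp _ (Metric.ball_mem_nhds 0 hr)
  refine ⟨t, fun t' ht' => hsU ?_⟩
  rw [Seminorm.mem_ball_zero]
  exact (seminorm_sum_le p t' f).trans_lt <| (le_abs_self _).trans_lt <|
    mem_ball_zero_iff.1 (ht t' ht')

variable {ι : Type*} {x : ι → E}

theorem summable_lp_one_smul [CompleteSpace E] (hx : IsVonNBounded 𝕜 (Set.range x))
    (a : ℓ¹(ι, 𝕜)) : Summable fun i => a i • x i :=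
  summable_of_summable_seminorm fun p hp =>
    have ⟨_, hC⟩ := exists_seminorm_smul_le hx hp
    Summable.of_nonneg_of_le (fun _ => apply_nonneg p _) (hC a)
      ((summable_norm_coeFn_lp_one a).mul_left _)

variable [CompleteSpace E] [T2Space E] [ContinuousSMul 𝕜 E]

/-- The synthesis operator `a ↦ ∑' i, a i • x i` of a bounded family `x` in a complete locally
convex space, defined on `ℓ¹`. -/
noncomputable def lpOneSum (hx : IsVonNBounded 𝕜 (Set.range x)) : ℓ¹(ι, 𝕜) →L[𝕜] E :=
  let S : ℓ¹(ι, 𝕜) →ₗ[𝕜] E :=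
    { toFun a := ∑' i, a i • x i
      map_add' a b := by
        simp only [lp.coeFn_add, Pi.add_apply, add_smul]
        exact (summable_lp_one_smul hx a).tsum_add (summable_lp_one_smul hx b)
      map_smul' c a := by
        simp only [lp.coeFn_smul, Pi.smul_apply, smul_assoc, RingHom.id_apply]
        exact (summable_lp_one_smul hx a).tsum_const_smul c }
  { S with
    cont := (PolynormableSpace.withSeminorms 𝕜 E).continuous_normedSpace_dom _ S fun ⟨p, hp⟩ => by
      obtain ⟨C, hC⟩ := exists_seminorm_smul_le hx hp
      refine ⟨C, fun a => ?_⟩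
      have ha := (summable_norm_coeFn_lp_one a).mul_left (C : ℝ)
      have hpa := ha.of_nonneg_of_le (fun i => apply_nonneg p _) (hC a)
      calc p (∑' i, a i • x i) ≤ ∑' i, p (a i • x i) :=
            seminorm_tsum_le hp (summable_lp_one_smul hx a) hpa
        _ ≤ ∑' i, C * ‖a i‖ := hpa.tsum_le_tsum (hC a) ha
        _ = C * ‖a‖ := by
          rw [tsum_mul_left, lp.norm_eq_tsum_rpow (by norm_num)]
          simp only [ENNReal.toReal_one, Real.rpow_one, div_one] }

theorem lpOneSum_single [DecidableEq ι] (hx : IsVonNBounded 𝕜 (Set.range x)) (i : ι) :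
    lpOneSum hx (lp.single 1 i 1) = x i := by
  refine (tsum_eq_single i fun j hj => ?_).trans ?_
  · rw [lp.single_apply_ne _ _ _ hj, zero_smul]
  · rw [lp.single_apply_self, one_smul]

/-- This is the Banach–Mackey theorem: the synthesis operator of `B` pulls `p` back to a lower
semicontinuous seminorm on a Banach space, which is automatically continuous. -/
theorem exists_seminorm_le_of_isVonNBounded {p : Seminorm 𝕜 E} (hp : LowerSemicontinuous p)
    {B : Set E} (hB : IsVonNBounded 𝕜 B) : ∃ C : ℝ, ∀ x ∈ B, p x ≤ C := by
  classical
  have hx : IsVonNBounded 𝕜 (Set.range ((↑) : B → E)) := by rwa [Subtype.range_coe]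
  have hcont : Continuous (p.comp (lpOneSum hx : ℓ¹(B, 𝕜) →ₗ[𝕜] E)) :=
    Seminorm.continuous_of_lowerSemicontinuous _ (hp.comp (lpOneSum hx).continuous)
  obtain ⟨C, -, hC⟩ := Seminorm.bound_of_continuous_normedSpace _ hcont
  refine ⟨C, fun b hb => ?_⟩
  have := hC (lp.single 1 ⟨b, hb⟩ 1)
  rwa [lp.norm_single one_pos, norm_one, mul_one, Seminorm.comp_apply,
    ContinuousLinearMap.coe_coe, lpOneSum_single] at this

end BanachMackey

section InducedTopologies

variable {𝕜 : Type*} [RCLike 𝕜] {X Y : Type*} [AddCommGroup X] [Module 𝕜 X] [AddCommGroup Y]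
  [Module 𝕜 Y]

theorem IsLocallyConvexHausdorff.induced {σ : TopologicalSpace Y}
    (hσ : IsLocallyConvexHausdorff 𝕜 σ) {T : X →ₗ[𝕜] Y} (hT : Function.Injective T) :
    IsLocallyConvexHausdorff 𝕜 (σ.induced T) := by
  have := hσ.isTopologicalAddGroup
  have := hσ.continuousSMul
  have := hσ.locallyConvexSpace
  have := hσ.t2Space
  refine ⟨topologicalAddGroup_induced T, continuousSMul_induced T, LocallyConvexSpace.induced T, ?_⟩
  let _ := σ.induced T
  exact (IsEmbedding.mk (IsInducing.induced T) hT).t2Space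

theorem absConvex_preimage {s : Set Y} (hs : AbsConvex 𝕜 s) (T : X →ₗ[𝕜] Y) :
    AbsConvex 𝕜 (T ⁻¹' s) :=
  ⟨hs.1.mulActionHom_preimage (f := T.toMulActionHom), hs.2.linear_preimage T⟩

theorem isBoundedFor_image_iff (σ : TopologicalSpace Y) (T : X ≃ₗ[𝕜] Y) {B : Set X} :
    IsBoundedFor 𝕜 σ (T '' B) ↔ IsBoundedFor 𝕜 (σ.induced T) B := by
  let _ := σ.induced T
  let e : X ≃L[𝕜] Y :=
    { T with
      continuous_toFun := continuous_induced_dom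
      continuous_invFun := continuous_induced_rng.2 <| by
        convert! continuous_id
        exact funext T.apply_symm_apply }
  exact ⟨fun h => e.symm_image_image B ▸ h.image (e.symm : Y →L[𝕜] X),
    fun h => h.image (e : X →L[𝕜] Y)⟩

theorem SatisfiesBBC.induced {σ σ' : TopologicalSpace Y} (h : SatisfiesBBC 𝕜 σ σ')
    (T : X ≃ₗ[𝕜] Y) : SatisfiesBBC 𝕜 (σ.induced T) (σ'.induced T) := by
  intro B hB
  obtain ⟨K, hBK, hK, hK_bdd, hK_compact⟩ := h (T '' B) ((isBoundedFor_image_iff σ T).2 hB)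
  have image_preimage : T '' (T ⁻¹' K) = K := Set.image_preimage_eq K T.surjective
  refine ⟨T ⁻¹' K, Set.image_subset_iff.1 hBK, absConvex_preimage hK T.toLinearMap,
    (isBoundedFor_image_iff σ T).1 (image_preimage.symm ▸ hK_bdd), ?_⟩
  let _ := σ'.induced T
  exact (IsInducing.induced T).isCompact_iff.2 (image_preimage.symm ▸ hK_compact)

theorem SatisfiesCNC.induced {σ σ' : TopologicalSpace Y} (h : SatisfiesCNC 𝕜 σ σ')
    (T : X →ₗ[𝕜] Y) : SatisfiesCNC 𝕜 (σ.induced T) (σ'.induced T) := by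
  have basis := h.comap T
  rw [← map_zero T, ← @nhds_induced _ _ σ] at basis
  refine basis.to_hasBasis' (fun U hU => ⟨T ⁻¹' U, ⟨basis.mem_of_mem hU,
    absConvex_preimage hU.2.1 T, isClosed_induced_iff.2 ⟨U, hU.2.2, rfl⟩⟩, le_rfl⟩) fun U hU => hU.1

end InducedTopologies

section WeakStarTopology

variable {𝕜 : Type*} [RCLike 𝕜] {E : Type*} [AddCommGroup E] [Module 𝕜 E] [TopologicalSpace E]

theorem locallyConvexSpace_weakDual : LocallyConvexSpace 𝕜 (WeakDual 𝕜 E) := by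
  have : LocallyConvexSpace 𝕜 𝕜 := locallyConvexSpace_rclike
  exact LocallyConvexSpace.induced ((LinearMap.ltoFun 𝕜 E 𝕜 𝕜).comp (topDualPairing 𝕜 E))

theorem mem_of_forall_norm_le_one_of_isClosed {S : Set (WeakDual 𝕜 E)}
    (hS : AbsConvex 𝕜 S) (hS_closed : IsClosed S) (hS_nonempty : S.Nonempty) {f : WeakDual 𝕜 E}
    (hf : ∀ y, (∀ g ∈ S, ‖g y‖ ≤ 1) → ‖f y‖ ≤ 1) : f ∈ S := by
  have := locallyConvexSpace_weakDual (𝕜 := 𝕜) (E := E)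
  let b : E →ₗ[𝕜] WeakDual 𝕜 E →ₗ[𝕜] 𝕜 := (topDualPairing 𝕜 E).flip
  have dual_eq (φ : StrongDual 𝕜 (WeakDual 𝕜 E)) : ∃ y, ∀ g, b y g = φ g :=
    let ⟨y, hy⟩ := (topDualPairing 𝕜 E).dualEmbedding_surjective φ
    ⟨y, fun g => DFunLike.congr_fun hy g⟩
  rw [← polar_flip_polar_eq_of_isClosed b dual_eq hS hS_closed hS_nonempty]
  exact hf

/-- The weak-* topology, as a second topology on the strong dual. -/
@[reducible]
noncomputable def weakStarTopology (𝕜 E : Type*) [RCLike 𝕜] [AddCommGroup E] [Module 𝕜 E]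
    [TopologicalSpace E] : TopologicalSpace (StrongDual 𝕜 E) :=
  TopologicalSpace.induced StrongDual.toWeakDual inferInstance

theorem isLocallyConvexHausdorff_weakStarTopology :
    IsLocallyConvexHausdorff 𝕜 (weakStarTopology 𝕜 E) :=
  IsLocallyConvexHausdorff.induced (σ := (inferInstance : TopologicalSpace (WeakDual 𝕜 E)))
    ⟨inferInstance, inferInstance, locallyConvexSpace_weakDual, inferInstance⟩
    (T := StrongDual.toWeakDual.toLinearMap) StrongDual.toWeakDual.injective

theorem satisfiesCNC_weakStarTopology [ContinuousConstSMul 𝕜 E] :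
    SatisfiesCNC 𝕜 (inferInstance : TopologicalSpace (StrongDual 𝕜 E)) (weakStarTopology 𝕜 E) := by
  have basis := hasBasis_nhds_zero_strongDual_polar (𝕜 := 𝕜) (E := E)
  refine basis.to_hasBasis' (fun B hB => ⟨StrongDual.polar 𝕜 B, ⟨basis.mem_of_mem hB,
    absConvex_polar _ _, ?_⟩, le_rfl⟩) fun U hU => hU.1
  exact isClosed_induced_iff.2 ⟨_, WeakDual.isClosed_polar 𝕜 B, rfl⟩

theorem exists_norm_le_of_mem_weakDual_polar [ContinuousSMul 𝕜 E] {U : Set E} (hU : U ∈ 𝓝 0)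
    (y : E) : ∃ C : ℝ, ∀ f ∈ WeakDual.polar 𝕜 U, ‖f y‖ ≤ C := by
  obtain ⟨c, hc⟩ := (absorbent_nhds_zero (𝕜 := 𝕜) hU y).exists
  obtain ⟨v, hv, rfl⟩ := hc rfl
  refine ⟨‖c‖, fun f hf => ?_⟩
  simp only [map_smul, norm_smul]
  exact mul_le_of_le_one_right (norm_nonneg c) (hf v hv)

theorem image_coeFn_weakDual_polar [IsTopologicalAddGroup E] [ContinuousSMul 𝕜 E] {U : Set E}
    (hU : U ∈ 𝓝 0) : (fun (f : WeakDual 𝕜 E) y => f y) '' WeakDual.polar 𝕜 U =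
      Set.range ((↑) : (E →ₗ[𝕜] 𝕜) → E → 𝕜) ∩ {g | ∀ y ∈ U, ‖g y‖ ≤ 1} := by
  ext g
  constructor
  · rintro ⟨f, hf, rfl⟩
    exact ⟨⟨f.toLinearMap, rfl⟩, hf⟩
  · rintro ⟨⟨g, rfl⟩, hg⟩
    have bounded : IsVonNBounded 𝕜 (g '' U) := by
      rw [NormedSpace.isVonNBounded_iff, isBounded_iff_forall_norm_le]
      exact ⟨1, Set.forall_mem_image.2 hg⟩
    exact ⟨g.clmOfExistsBoundedImage ⟨U, hU, bounded⟩, hg, rfl⟩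

theorem isCompact_weakDual_polar [IsTopologicalAddGroup E] [ContinuousSMul 𝕜 E] {U : Set E}
    (hU : U ∈ 𝓝 0) : IsCompact (WeakDual.polar 𝕜 U) := by
  choose C hC using exists_norm_le_of_mem_weakDual_polar (𝕜 := 𝕜) hU
  have embedding : IsEmbedding fun (f : WeakDual 𝕜 E) y => f y :=
    WeakBilin.isEmbedding ContinuousLinearMap.coe_injective
  rw [embedding.isCompact_iff]
  refine (isCompact_univ_pi fun y => isCompact_closedBall (0 : 𝕜) (C y)).of_isClosed_subset ?_ ?_
  · rw [image_coeFn_weakDual_polar hU]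
    refine (LinearMap.isClosed_range_coe _ _ _).inter ?_
    simp only [Set.ofPred_forall]
    exact isClosed_biInter fun y _ => isClosed_le (continuous_apply y).norm continuous_const
  · rintro _ ⟨f, hf, rfl⟩ y -
    exact mem_closedBall_zero_iff.2 (hC y f hf)

end WeakStarTopology

section Barrelled

variable {𝕜 : Type*} [RCLike 𝕜] {E : Type*} [AddCommGroup E] [Module 𝕜 E] [UniformSpace E]
  [IsUniformAddGroup E] [ContinuousSMul 𝕜 E]

theorem equicontinuous_of_isVonNBounded_strongDual [BarrelledSpace 𝕜 E]
    {B : Set (StrongDual 𝕜 E)} (hB : IsVonNBounded 𝕜 B) :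
    Equicontinuous fun (f : B) (y : E) => f.1 y := by
  refine (PolynormableSpace.banach_steinhaus fun y => ?_).equicontinuous
  have := ContinuousLinearMap.isVonNBounded_image2_apply hB (isVonNBounded_singleton y)
  rw [Set.image2_singleton_right, Set.image_eq_range] at this
  exact this

theorem polar_mem_nhds_zero_of_isVonNBounded [BarrelledSpace 𝕜 E]
    {B : Set (StrongDual 𝕜 E)} (hB : IsVonNBounded 𝕜 B) :
    (topDualPairing 𝕜 E).polar B ∈ 𝓝 0 := by
  filter_upwards [Metric.equicontinuousAt_iff_right.1
    (equicontinuous_of_isVonNBounded_strongDual hB 0) 1 one_pos] with y hy f hf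
  have := hy ⟨f, hf⟩
  rw [map_zero, dist_zero_left] at this
  exact this.le

theorem satisfiesBBC_weakStarTopology [BarrelledSpace 𝕜 E] :
    SatisfiesBBC 𝕜 (inferInstance : TopologicalSpace (StrongDual 𝕜 E)) (weakStarTopology 𝕜 E) := by
  intro B hB
  have nhds := polar_mem_nhds_zero_of_isVonNBounded hB
  let _ := weakStarTopology 𝕜 E
  refine ⟨StrongDual.polar 𝕜 ((topDualPairing 𝕜 E).polar B),
    (topDualPairing 𝕜 E).subset_bipolar B, absConvex_polar _ _,
    isVonNBounded_strongDual_polar fun C hC => hC nhds, ?_⟩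
  exact (IsInducing.induced StrongDual.toWeakDual).isCompact_iff.2 <| by
    rw [LinearEquiv.image_eq_preimage_symm]
    exact isCompact_weakDual_polar nhds

theorem barrelledSpace_of_polar_mem_nhds_zero [LocallyConvexSpace 𝕜 E] [CompleteSpace E] [T2Space E]
    (h : ∀ A : Set (StrongDual 𝕜 E), IsVonNBounded 𝕜 A → (topDualPairing 𝕜 E).polar A ∈ 𝓝 0) :
    BarrelledSpace 𝕜 E := by
  refine ⟨fun p hp => Seminorm.continuous' (r := 1) ?_⟩
  have := polynormableSpace_of_locallyConvexSpace (𝕜 := 𝕜) (E := E)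
  have closed : IsClosed (p.closedBall 0 1) := by
    rw [Seminorm.closedBall_zero_eq]
    exact hp.isClosed_preimage 1
  have bipolar : (topDualPairing 𝕜 E).polar (StrongDual.polar 𝕜 (p.closedBall 0 1)) =
      p.closedBall 0 1 :=
    polar_flip_polar_eq_of_isClosed _ (fun f => ⟨f, fun _ => rfl⟩)
      (absConvex_seminorm_closedBall_zero p 1) closed ⟨0, by simp⟩
  rw [← bipolar]
  refine h _ (isVonNBounded_strongDual_polar fun B hB => ?_)
  obtain ⟨r, hr⟩ := exists_seminorm_le_of_isVonNBounded hp hB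
  have subset_ball : B ⊆ p.ball 0 (r + 1) := fun x hx =>
    p.mem_ball_zero.2 ((hr x hx).trans_lt (lt_add_one r))
  exact ((p.ball_zero_absorbs_ball_zero one_pos).mono_right subset_ball).mono_left
    (p.ball_subset_closedBall 0 1)

end Barrelled

theorem isClosed_setOf_forall_mem_continuousOn {α β : Type*} [TopologicalSpace α] [UniformSpace β]
    (𝔖 : Set (Set α)) :
    IsClosed {f : UniformOnFun α β 𝔖 | ∀ s ∈ 𝔖, ContinuousOn (UniformOnFun.toFun 𝔖 f) s} := by
  refine isClosed_iff_forall_filter.2 fun f u _ hu huf s hs => ?_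
  rw [← tendsto_id', UniformOnFun.tendsto_iff_tendstoUniformlyOn] at huf
  exact (huf s hs).continuousOn <| Eventually.frequently <| hu fun _ hg => hg s hs

theorem IsLocallyConvexHausdorff.isBoundedFor_singleton {𝕜 X : Type*} [RCLike 𝕜] [AddCommGroup X]
    [Module 𝕜 X] {τ : TopologicalSpace X} (hτ : IsLocallyConvexHausdorff 𝕜 τ) (x : X) :
    IsBoundedFor 𝕜 τ {x} :=
  let _ := τ
  have := hτ.continuousSMul
  isVonNBounded_singleton x

theorem IsLocallyConvexHausdorff.sUnion_isBoundedFor_eq_univ {𝕜 X : Type*} [RCLike 𝕜]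
    [AddCommGroup X] [Module 𝕜 X] {τ : TopologicalSpace X} (hτ : IsLocallyConvexHausdorff 𝕜 τ) :
    ⋃₀ {B : Set X | IsBoundedFor 𝕜 τ B} = Set.univ :=
  Set.eq_univ_of_forall fun x => ⟨{x}, hτ.isBoundedFor_singleton x, rfl⟩

/-- The predual `(X'_{𝓑, τ'}, β)` of `(X, τ)`, lifted to a possibly larger universe. It is a type
of its own so that it can carry a uniform structure inducing `boundedlyContinuousDualTopology`. -/
def Predual (𝕜 : Type v) [RCLike 𝕜] {X : Type u} [AddCommGroup X] [Module 𝕜 X]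
    (τ τ' : TopologicalSpace X) : Type (max u v w) :=
  ULift.{w} (boundedlyContinuousDual 𝕜 τ τ')

namespace Predual

variable {𝕜 : Type v} [RCLike 𝕜] {X : Type u} [AddCommGroup X] [Module 𝕜 X]
  {τ τ' : TopologicalSpace X}

instance : AddCommGroup (Predual.{u, v, w} 𝕜 τ τ') :=
  inferInstanceAs (AddCommGroup (ULift (boundedlyContinuousDual 𝕜 τ τ')))

instance : Module 𝕜 (Predual.{u, v, w} 𝕜 τ τ') :=
  inferInstanceAs (Module 𝕜 (ULift (boundedlyContinuousDual 𝕜 τ τ')))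

variable (𝕜 τ τ') in
/-- The canonical pairing of the predual with the space. -/
def pairing : Predual.{u, v, w} 𝕜 τ τ' →ₗ[𝕜] X →ₗ[𝕜] 𝕜 :=
  (boundedlyContinuousDual 𝕜 τ τ').subtype.comp ULift.moduleEquiv.toLinearMap

theorem pairing_injective : Function.Injective (pairing.{u, v, w} 𝕜 τ τ') :=
  Subtype.val_injective.comp ULift.moduleEquiv.injective

theorem continuousOn_pairing (z : Predual.{u, v, w} 𝕜 τ τ') {B : Set X} (hB : IsBoundedFor 𝕜 τ B) :
    @ContinuousOn X 𝕜 τ' _ (pairing 𝕜 τ τ' z) B :=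
  z.down.2 B hB

theorem exists_pairing_eq_of_continuous {f : Module.Dual 𝕜 X} (hf : @Continuous X 𝕜 τ' _ f) :
    ∃ z : Predual.{u, v, w} 𝕜 τ τ', pairing 𝕜 τ τ' z = f :=
  ⟨⟨f, fun _ _ => @Continuous.continuousOn X 𝕜 τ' _ _ _ hf⟩, rfl⟩

variable (𝕜 τ τ') in
/-- The pairing, with values in the functions under uniform convergence on the bounded sets. -/
def toUniformOnFun :
    Predual.{u, v, w} 𝕜 τ τ' →+ UniformOnFun X 𝕜 {B : Set X | IsBoundedFor 𝕜 τ B} where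
  toFun z := UniformOnFun.ofFun _ (pairing 𝕜 τ τ' z)
  map_zero' := by rw [map_zero]; rfl
  map_add' y z := by rw [map_add]; rfl

instance : UniformSpace (Predual.{u, v, w} 𝕜 τ τ') :=
  .comap (toUniformOnFun 𝕜 τ τ') inferInstance

theorem isUniformInducing_toUniformOnFun :
    IsUniformInducing (toUniformOnFun.{u, v, w} 𝕜 τ τ') :=
  ⟨rfl⟩

instance : IsUniformAddGroup (Predual.{u, v, w} 𝕜 τ τ') :=
  isUniformInducing_toUniformOnFun.isUniformAddGroup (toUniformOnFun 𝕜 τ τ')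

theorem continuousSMul (hBBC : SatisfiesBBC 𝕜 τ τ') :
    ContinuousSMul 𝕜 (Predual.{u, v, w} 𝕜 τ τ') := by
  refine UniformOnFun.continuousSMul_induced_of_image_bounded 𝕜 X 𝕜 _
    ((LinearMap.ltoFun 𝕜 X 𝕜 𝕜).comp (pairing 𝕜 τ τ'))
    isUniformInducing_toUniformOnFun.isInducing fun z B hB => ?_
  obtain ⟨K, hBK, -, hK_bdd, hK_compact⟩ := hBBC B hB
  let _ := τ'
  exact ((hK_compact.image_of_continuousOn (continuousOn_pairing z hK_bdd)).isVonNBounded 𝕜).subset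
    (Set.image_mono hBK)

theorem hasBasis_nhds_zero (hτ : IsLocallyConvexHausdorff 𝕜 τ) :
    (𝓝 (0 : Predual.{u, v, w} 𝕜 τ τ')).HasBasis (· ∈ {B : Set X | IsBoundedFor 𝕜 τ B})
      (pairing 𝕜 τ τ').flip.polar := by
  let _ := τ
  have := hτ.continuousSMul
  exact hasBasis_nhds_zero_polar_of_isInducing ⟨∅, isVonNBounded_empty 𝕜 X⟩
    (directedOn_of_sup_mem fun _ _ => IsVonNBounded.union) (fun c _ hB => isVonNBounded_smul hB c)
    isUniformInducing_toUniformOnFun.isInducing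

theorem locallyConvexSpace (hτ : IsLocallyConvexHausdorff 𝕜 τ) :
    LocallyConvexSpace 𝕜 (Predual.{u, v, w} 𝕜 τ τ') :=
  LocallyConvexSpace.ofBasisZero 𝕜 _ _ _ (hasBasis_nhds_zero hτ) fun B _ =>
    (absConvex_polar (pairing 𝕜 τ τ').flip B).2

theorem t2Space (hτ : IsLocallyConvexHausdorff 𝕜 τ) : T2Space (Predual.{u, v, w} 𝕜 τ τ') := by
  have := UniformOnFun.t2Space_of_covering (β := 𝕜) hτ.sUnion_isBoundedFor_eq_univ
  have injective : Function.Injective (toUniformOnFun.{u, v, w} 𝕜 τ τ') :=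
    (UniformOnFun.ofFun _).injective.comp (DFunLike.coe_injective.comp pairing_injective)
  exact (IsEmbedding.mk isUniformInducing_toUniformOnFun.isInducing injective).t2Space

theorem range_toUniformOnFun : Set.range (toUniformOnFun.{u, v, w} 𝕜 τ τ') =
    UniformOnFun.toFun _ ⁻¹' Set.range ((↑) : (X →ₗ[𝕜] 𝕜) → X → 𝕜) ∩
      {f | ∀ B ∈ {B | IsBoundedFor 𝕜 τ B}, @ContinuousOn X 𝕜 τ' _ (UniformOnFun.toFun _ f) B} := by
  ext f
  constructor
  · rintro ⟨z, rfl⟩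
    exact ⟨⟨pairing 𝕜 τ τ' z, rfl⟩, fun _ => continuousOn_pairing z⟩
  · rintro ⟨⟨g, hg⟩, hf⟩
    exact ⟨⟨g, fun B hB => hg ▸ hf B hB⟩, hg⟩

theorem completeSpace (hτ : IsLocallyConvexHausdorff 𝕜 τ) :
    CompleteSpace (Predual.{u, v, w} 𝕜 τ τ') := by
  rw [completeSpace_iff_isComplete_range isUniformInducing_toUniformOnFun, range_toUniformOnFun]
  have isClosed_linear := (LinearMap.isClosed_range_coe X 𝕜 (RingHom.id 𝕜)).preimage
    (UniformOnFun.uniformContinuous_toFun hτ.sUnion_isBoundedFor_eq_univ).continuous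
  exact (isClosed_linear.inter
    (@isClosed_setOf_forall_mem_continuousOn X 𝕜 τ' _ {B | IsBoundedFor 𝕜 τ B})).isComplete

theorem polar_flip_polar_eq (hτ' : IsLocallyConvexHausdorff 𝕜 τ') {U : Set X}
    (hU : AbsConvex 𝕜 U) (hU_closed : IsClosed[τ'] U) (hU_nonempty : U.Nonempty) :
    (pairing.{u, v, w} 𝕜 τ τ').polar ((pairing 𝕜 τ τ').flip.polar U) = U := by
  let _ := τ'
  have := hτ'.isTopologicalAddGroup
  have := hτ'.continuousSMul
  have := hτ'.locallyConvexSpace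
  refine polar_flip_polar_eq_of_isClosed _ (fun f => ?_) hU hU_closed hU_nonempty
  obtain ⟨z, hz⟩ := exists_pairing_eq_of_continuous (τ := τ) f.continuous
  exact ⟨z, LinearMap.congr_fun hz⟩

/-- The map of `X` into the dual of its predual. -/
def evaluation (hτ : IsLocallyConvexHausdorff 𝕜 τ) :
    X →ₗ[𝕜] StrongDual 𝕜 (Predual.{u, v, w} 𝕜 τ τ') where
  toFun x :=
    { toLinearMap := (pairing 𝕜 τ τ').flip x
      cont := (UniformOnFun.uniformContinuous_eval_of_mem 𝕜 _ (Set.mem_singleton x)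
        (hτ.isBoundedFor_singleton x)).continuous.comp
          isUniformInducing_toUniformOnFun.isInducing.continuous }
  map_add' x y := by ext z; exact map_add (pairing 𝕜 τ τ' z) x y
  map_smul' c x := by ext z; exact map_smul (pairing 𝕜 τ τ' z) c x

theorem evaluation_injective (hτ : IsLocallyConvexHausdorff 𝕜 τ)
    (hτ' : IsLocallyConvexHausdorff 𝕜 τ') :
    Function.Injective (evaluation.{u, v, w} (τ' := τ') hτ) := by
  let _ := τ'
  have := hτ'.t2Space
  refine (injective_iff_map_eq_zero _).2 fun x hx => ?_
  have absConvex_zero : AbsConvex 𝕜 ({0} : Set X) :=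
    ⟨balanced_iff_smul_mem.2 fun _ _ _ => by simp_all, convex_singleton 0⟩
  rw [← Set.mem_singleton_iff, ← polar_flip_polar_eq.{u, v, w} (τ := τ) hτ' absConvex_zero
    isClosed_singleton (Set.singleton_nonempty 0)]
  intro z _
  have : pairing 𝕜 τ τ' z x = 0 := DFunLike.congr_fun hx z
  rw [this, norm_zero]
  exact zero_le_one

theorem continuousOn_evaluation (hτ : IsLocallyConvexHausdorff 𝕜 τ) {B : Set X}
    (hB : IsBoundedFor 𝕜 τ B) :
    @ContinuousOn X _ τ' _ (fun x =>
      StrongDual.toWeakDual (evaluation.{u, v, w} (τ' := τ') hτ x)) B := by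
  let _ := τ'
  exact continuousOn_iff_continuous_domRestrict.2 <| WeakDual.continuous_of_continuous_eval fun z =>
    continuousOn_iff_continuous_domRestrict.1 (continuousOn_pairing z hB)

theorem evaluation_surjective (hτ : IsLocallyConvexHausdorff 𝕜 τ) (hBBC : SatisfiesBBC 𝕜 τ τ') :
    Function.Surjective (evaluation.{u, v, w} (τ' := τ') hτ) := by
  intro f
  have := continuousSMul.{u, v, w} hBBC
  have unitBall_mem : {z | ‖f z‖ ≤ 1} ∈ 𝓝 0 :=
    (f.continuous.norm.tendsto 0).eventually_le_const (by simp)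
  obtain ⟨B, hB, hBf⟩ := (hasBasis_nhds_zero hτ).mem_iff.1 unitBall_mem
  obtain ⟨K, hBK, hK, hK_bdd, hK_compact⟩ := hBBC (insert 0 B) <|
    @IsVonNBounded.union 𝕜 X _ _ _ τ _ _ (hτ.isBoundedFor_singleton 0) hB
  let e := StrongDual.toWeakDual.toLinearMap.comp (evaluation.{u, v, w} (τ' := τ') hτ)
  have isCompact_image : IsCompact (e '' K) :=
    @IsCompact.image_of_continuousOn _ _ τ' _ _ _ hK_compact (continuousOn_evaluation hτ hK_bdd)
  have absConvex_image : AbsConvex 𝕜 (e '' K) := by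
    refine ⟨balanced_iff_smul_mem.2 ?_, hK.2.linear_image e⟩
    rintro c hc _ ⟨x, hx, rfl⟩
    exact ⟨c • x, hK.1.smul_mem hc hx, map_smul e c x⟩
  obtain ⟨x, -, hx⟩ : StrongDual.toWeakDual f ∈ e '' K :=
    mem_of_forall_norm_le_one_of_isClosed absConvex_image isCompact_image.isClosed
      ⟨e 0, 0, hBK (Set.mem_insert 0 B), rfl⟩ fun z hz => hBf fun x hx =>
        hz (e x) ⟨x, hBK (Set.mem_insert_of_mem 0 hx), rfl⟩
  exact ⟨x, StrongDual.toWeakDual.injective hx⟩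

theorem hasBasis_nhds_zero_polar (hτ : IsLocallyConvexHausdorff 𝕜 τ) (hborn : IsBornological 𝕜 τ)
    (hτ' : IsLocallyConvexHausdorff 𝕜 τ') (hCNC : SatisfiesCNC 𝕜 τ τ') :
    (@nhds X τ 0).HasBasis (· ∈ {A : Set (Predual.{u, v, w} 𝕜 τ τ') | IsVonNBounded 𝕜 A})
      (pairing 𝕜 τ τ').polar := by
  have bounded_iff (A : Set (Predual.{u, v, w} 𝕜 τ τ')) :=
    isVonNBounded_iff_absorbs_polar (hasBasis_nhds_zero (τ' := τ') hτ) (A := A)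
  refine hCNC.to_hasBasis' ?_ fun A hA =>
    hborn _ (absConvex_polar _ A) ((bounded_iff A).1 hA)
  rintro U ⟨hU, hU_absConvex, hU_closed⟩
  have bipolar := polar_flip_polar_eq.{u, v, w} (τ := τ) hτ' hU_absConvex hU_closed
    ⟨0, @mem_of_mem_nhds X τ 0 U hU⟩
  exact ⟨_, (bounded_iff _).2 fun B hB => bipolar.symm ▸ hB hU, bipolar.subset⟩

theorem eq_induced_evaluation (hτ : IsLocallyConvexHausdorff 𝕜 τ) (hborn : IsBornological 𝕜 τ)
    (hτ' : IsLocallyConvexHausdorff 𝕜 τ') (hBBC : SatisfiesBBC 𝕜 τ τ')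
    (hCNC : SatisfiesCNC 𝕜 τ τ') :
    τ = .induced (evaluation.{u, v, w} (τ' := τ') hτ) inferInstance := by
  have := continuousSMul.{u, v, w} hBBC
  refine IsTopologicalAddGroup.ext hτ.isTopologicalAddGroup (topologicalAddGroup_induced _)
    ((hasBasis_nhds_zero_polar.{u, v, w} hτ hborn hτ' hCNC).eq_of_same_basis ?_)
  rw [nhds_induced, map_zero]
  exact hasBasis_nhds_zero_strongDual_polar.comap _

/-- `Predual.evaluation` as an isomorphism onto the dual of the predual. -/
noncomputable def evaluationEquiv (hτ : IsLocallyConvexHausdorff 𝕜 τ)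
    (hτ' : IsLocallyConvexHausdorff 𝕜 τ') (hBBC : SatisfiesBBC 𝕜 τ τ') :
    X ≃ₗ[𝕜] StrongDual 𝕜 (Predual.{u, v, w} 𝕜 τ τ') :=
  .ofBijective (evaluation hτ) ⟨evaluation_injective hτ hτ', evaluation_surjective hτ hBBC⟩

theorem isHomeomorph_evaluationEquiv (hτ : IsLocallyConvexHausdorff 𝕜 τ)
    (hborn : IsBornological 𝕜 τ) (hτ' : IsLocallyConvexHausdorff 𝕜 τ')
    (hBBC : SatisfiesBBC 𝕜 τ τ') (hCNC : SatisfiesCNC 𝕜 τ τ') :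
    @IsHomeomorph X _ τ _ (evaluationEquiv.{u, v, w} hτ hτ' hBBC) := by
  let T := evaluationEquiv.{u, v, w} hτ hτ' hBBC
  exact (@isHomeomorph_iff_isEmbedding_surjective X _ τ _ T).2
    ⟨@IsEmbedding.mk X _ τ _ T (@IsInducing.mk X _ τ _ T
      (eq_induced_evaluation hτ hborn hτ' hBBC hCNC)) T.injective, T.surjective⟩

theorem barrelledSpace (hτ : IsLocallyConvexHausdorff 𝕜 τ) (hborn : IsBornological 𝕜 τ)
    (hτ' : IsLocallyConvexHausdorff 𝕜 τ') (hBBC : SatisfiesBBC 𝕜 τ τ')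
    (hCNC : SatisfiesCNC 𝕜 τ τ') : BarrelledSpace 𝕜 (Predual.{u, v, w} 𝕜 τ τ') := by
  have := continuousSMul.{u, v, w} hBBC
  have := locallyConvexSpace.{u, v, w} (τ' := τ') hτ
  have := completeSpace.{u, v, w} (τ' := τ') hτ
  have := t2Space.{u, v, w} (τ' := τ') hτ
  refine barrelledSpace_of_polar_mem_nhds_zero fun A hA => ?_
  let T := evaluationEquiv.{u, v, w} hτ hτ' hBBC
  obtain ⟨B, rfl⟩ : ∃ B, T '' B = A := ⟨T ⁻¹' A, Set.image_preimage_eq A T.surjective⟩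
  have hB : IsBoundedFor 𝕜 τ B := by
    rw [eq_induced_evaluation.{u, v, w} hτ hborn hτ' hBBC hCNC]
    exact (isBoundedFor_image_iff _ T).1 hA
  filter_upwards [(hasBasis_nhds_zero hτ).mem_of_mem hB] with z hz
  exact Set.forall_mem_image.2 hz

end Predual

section UniformConvergenceOnCompacts

variable {Ω E β : Type*} [TopologicalSpace Ω] [TopologicalSpace E]

theorem continuous_uncurry_of_continuous_uniformOnFun [UniformSpace β] {𝔖 : Set (Set Ω)}
    {Φ : E → Ω → β} (hΦ : Continuous fun e => UniformOnFun.ofFun 𝔖 (Φ e)) {C : Set Ω} (hC : C ∈ 𝔖)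
    (hΦ_cont : ∀ e, ContinuousOn (Φ e) C) : Continuous fun p : C × E => Φ p.2 p.1 := by
  refine continuous_iff_continuousAt.2 fun ⟨x, e⟩ => ?_
  have unif : TendstoUniformlyOn Φ (Φ e) (𝓝 e) C :=
    UniformOnFun.tendsto_iff_tendstoUniformlyOn.1 (hΦ.tendsto e) C hC
  have tendsto_fst : Tendsto (fun p : C × E => p.1.1) (𝓝 (x, e)) (𝓝[C] x) :=
    tendsto_nhdsWithin_iff.2 ⟨(continuous_subtype_val.comp continuous_fst).tendsto _,
      .of_forall fun p => p.1.2⟩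
  exact tendsto_comp_of_locally_uniform_limit_within (F := fun p : C × E => Φ p.2)
    (hΦ_cont e x x.2) tendsto_fst fun u hu =>
      ⟨C, self_mem_nhdsWithin, (continuous_snd.tendsto (x, e)).eventually (unif u hu)⟩

end UniformConvergenceOnCompacts

namespace IsGkRSpace

variable {Ω : Type u} [TopologicalSpace Ω]

theorem continuous_of_forall_isCompact (hΩ : IsGkRSpace.{u, w'} Ω) {g : Ω → ℝ}
    (hg : ∀ C, IsCompact C → ContinuousOn g C) : Continuous g := by
  have : CompletelyRegularSpace (ULift.{w'} ℝ) :=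
    Homeomorph.ulift.isInducing.completelyRegularSpace
  exact continuous_uliftDown.comp <| hΩ (ULift.{w'} ℝ) (fun x => ⟨g x⟩) fun C hC =>
    continuous_uliftUp.comp_continuousOn (hg C hC)

/-- The deviation `x ↦ sup_e d(Φ e x₀, Φ e x)` is continuous on compact sets, hence continuous. -/
theorem equicontinuous_of_compactSpace (hΩ : IsGkRSpace.{u, w'} Ω) {E β : Type*}
    [TopologicalSpace E] [CompactSpace E] [PseudoMetricSpace β] {Φ : E → Ω → β}
    (hΦ : Continuous fun e => UniformOnFun.ofFun {C : Set Ω | IsCompact C} (Φ e))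
    (hΦ_cont : ∀ e, Continuous (Φ e)) : Equicontinuous Φ := by
  intro x₀
  have continuous_eval (x : Ω) : Continuous fun e => Φ e x :=
    (UniformOnFun.uniformContinuous_eval_of_mem β {C : Set Ω | IsCompact C} (Set.mem_singleton x)
      isCompact_singleton).continuous.comp hΦ
  let deviation (x : Ω) : ℝ := sSup ((fun e => dist (Φ e x₀) (Φ e x)) '' Set.univ)
  have continuous_deviation : Continuous deviation := by
    refine hΩ.continuous_of_forall_isCompact fun C hC => ?_
    rw [continuousOn_iff_continuous_domRestrict]
    exact isCompact_univ.continuous_sSup (f := fun (x : C) e => dist (Φ e x₀) (Φ e x)) <|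
      ((continuous_eval x₀).comp continuous_snd).dist <|
        continuous_uncurry_of_continuous_uniformOnFun hΦ hC fun e => (hΦ_cont e).continuousOn
  have deviation_self : deviation x₀ ≤ 0 :=
    Real.sSup_nonpos (Set.forall_mem_image.2 fun e _ => (dist_self _).le)
  refine Metric.equicontinuousAt_iff_right.2 fun ε hε => ?_
  filter_upwards [continuous_deviation.continuousAt.eventually_lt_const
    (deviation_self.trans_lt hε)] with x hx e
  have bddAbove := isCompact_univ.bddAbove_image
    ((continuous_eval x₀).dist (continuous_eval x)).continuousOn
  exact (le_csSup bddAbove ⟨e, Set.mem_univ e, rfl⟩).trans_lt hx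

end IsGkRSpace

section FunctionSpaces

variable {𝕜 : Type v} [RCLike 𝕜] {Ω : Type u} {F : Submodule 𝕜 (Ω → 𝕜)} {τ τ' : TopologicalSpace F}

theorem compactOpenTopology_le_pointwiseTopology [TopologicalSpace Ω] :
    compactOpenTopology F ≤ pointwiseTopology F := by
  let _ := compactOpenTopology F
  exact continuous_iff_le_induced.1 <| continuous_pi fun x =>
    (UniformOnFun.uniformContinuous_eval_of_mem 𝕜 {K : Set Ω | IsCompact K} (Set.mem_singleton x)
      isCompact_singleton).continuous.comp continuous_induced_dom

theorem pointEvaluation_mem_boundedlyContinuousDual (hle : τ' ≤ pointwiseTopology F) (x : Ω) :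
    pointEvaluation F x ∈ boundedlyContinuousDual 𝕜 τ τ' := fun B _ => by
  let _ := τ'
  exact ((continuous_apply x).comp (continuous_iff_le_induced.2 hle)).continuousOn

namespace IsStrongLinearisation

variable {Y : Type*} [AddCommGroup Y] [Module 𝕜 Y] {δ : Ω → Y}

theorem eq_induced [TopologicalSpace Y] {T : F ≃ₗ[𝕜] StrongDual 𝕜 Y}
    (h : IsStrongLinearisation F τ δ T) : τ = .induced T inferInstance :=
  (@IsHomeomorph.isInducing F _ τ _ T h.isHomeomorph).eq_induced

theorem induced_weakStarTopology_le [TopologicalSpace Y] {T : F ≃ₗ[𝕜] StrongDual 𝕜 Y}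
    (h : IsStrongLinearisation F τ δ T) :
    (weakStarTopology 𝕜 Y).induced T ≤ pointwiseTopology F := by
  rw [induced_compose]
  let _ := TopologicalSpace.induced (StrongDual.toWeakDual ∘ T) inferInstance
  refine continuous_iff_le_induced.1 (continuous_pi fun x => ?_)
  simp only [← h.comp_eq]
  exact (WeakDual.eval_continuous (δ x)).comp continuous_induced_dom

variable [UniformSpace Y] [IsUniformAddGroup Y] [ContinuousSMul 𝕜 Y] [BarrelledSpace 𝕜 Y]
  {T : F ≃ₗ[𝕜] StrongDual 𝕜 Y}

theorem equicontinuous [TopologicalSpace Ω] (h : IsStrongLinearisation F τ δ T)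
    (hδ : Continuous δ) {B : Set F} (hB : IsBoundedFor 𝕜 τ B) :
    Equicontinuous fun f : B => (f.1.1 : Ω → 𝕜) := by
  rw [h.eq_induced, ← isBoundedFor_image_iff] at hB
  have equicontinuous_image := (equicontinuous_of_isVonNBounded_strongDual hB).comp
    fun f : B => ⟨T f.1, Set.mem_image_of_mem T f.2⟩
  simp only [← h.comp_eq]
  exact equicontinuous_iff_continuous.2
    ((equicontinuous_iff_continuous.1 equicontinuous_image).comp hδ)

theorem exists_satisfiesBBC_satisfiesCNC (h : IsStrongLinearisation F τ δ T) :
    ∃ τ' : TopologicalSpace F, IsLocallyConvexHausdorff 𝕜 τ' ∧ SatisfiesBBC 𝕜 τ τ' ∧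
      SatisfiesCNC 𝕜 τ τ' ∧ τ' ≤ pointwiseTopology F := by
  obtain rfl := h.eq_induced
  exact ⟨(weakStarTopology 𝕜 Y).induced T,
    isLocallyConvexHausdorff_weakStarTopology.induced (T := T.toLinearMap) T.injective,
    satisfiesBBC_weakStarTopology.induced T, satisfiesCNC_weakStarTopology.induced T.toLinearMap,
    h.induced_weakStarTopology_le⟩

end IsStrongLinearisation

variable [TopologicalSpace Ω]

/-- The map `x ↦ δ_x` of assertion (c) is well defined and continuous. -/
def HasContinuousPointEvaluation (F : Submodule 𝕜 (Ω → 𝕜)) (τ τ' : TopologicalSpace F) : Prop :=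
  ∃ hδ : ∀ x : Ω, pointEvaluation F x ∈ boundedlyContinuousDual 𝕜 τ τ',
    @Continuous Ω (boundedlyContinuousDual 𝕜 τ τ') _ (boundedlyContinuousDualTopology 𝕜 τ τ')
      (fun x => ⟨pointEvaluation F x, hδ x⟩)

theorem hasContinuousPointEvaluation_of_equicontinuous (hle : τ' ≤ pointwiseTopology F)
    (heq : ∀ B : Set F, IsBoundedFor 𝕜 τ B → Equicontinuous fun f : B => (f.1.1 : Ω → 𝕜)) :
    HasContinuousPointEvaluation F τ τ' :=
  ⟨pointEvaluation_mem_boundedlyContinuousDual hle, continuous_induced_rng.2 <|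
    UniformOnFun.continuous_rng_iff.2 fun B hB => equicontinuous_iff_continuous.1 (heq B hB)⟩

theorem equicontinuous_of_isBoundedFor_of_isGkRSpace (hΩ : IsGkRSpace.{u, w'} Ω)
    (hF : ∀ f ∈ F, Continuous f) (hBBC : SatisfiesBBC 𝕜 τ τ') (hle : τ' ≤ compactOpenTopology F)
    {B : Set F} (hB : IsBoundedFor 𝕜 τ B) : Equicontinuous fun f : B => (f.1.1 : Ω → 𝕜) := by
  obtain ⟨K, hBK, -, -, hK⟩ := hBBC B hB
  let _ := τ'
  have := isCompact_iff_compactSpace.1 hK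
  exact (hΩ.equicontinuous_of_compactSpace (Φ := fun f : K => f.1.1)
    ((continuous_iff_le_induced.2 hle).comp continuous_subtype_val)
    fun f => hF f.1 f.1.2).comp (Set.inclusion hBK)

theorem HasContinuousPointEvaluation.admitsLinearisation
    (hδ : HasContinuousPointEvaluation F τ τ') (hτ : IsLocallyConvexHausdorff 𝕜 τ)
    (hborn : IsBornological 𝕜 τ) (hτ' : IsLocallyConvexHausdorff 𝕜 τ')
    (hBBC : SatisfiesBBC 𝕜 τ τ') (hCNC : SatisfiesCNC 𝕜 τ τ') :
    AdmitsContinuousStrongCompleteBarrelledLinearisation.{u, v, w} F τ := by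
  obtain ⟨hδ, hδ_cont⟩ := hδ
  have hδ_unif := continuous_induced_rng.1 hδ_cont
  exact ⟨Predual.{max u v, v, w} 𝕜 τ τ', inferInstance, inferInstance, inferInstance, inferInstance,
    Predual.continuousSMul hBBC, Predual.locallyConvexSpace hτ, Predual.t2Space hτ,
    fun x => ⟨⟨pointEvaluation F x, hδ x⟩⟩, Predual.evaluationEquiv hτ hτ' hBBC,
    Predual.completeSpace hτ, Predual.barrelledSpace hτ hborn hτ' hBBC hCNC,
    ⟨Predual.isHomeomorph_evaluationEquiv hτ hborn hτ' hBBC hCNC, fun _ => rfl⟩,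
    Predual.isUniformInducing_toUniformOnFun.isInducing.continuous_iff.2 hδ_unif⟩

theorem AdmitsContinuousStrongCompleteBarrelledLinearisation.exists_bbc_cnc
    (h : AdmitsContinuousStrongCompleteBarrelledLinearisation.{u, v, w} F τ) :
    (∃ τ' : TopologicalSpace F, IsLocallyConvexHausdorff 𝕜 τ' ∧
        SatisfiesBBC 𝕜 τ τ' ∧ SatisfiesCNC 𝕜 τ τ' ∧ τ' ≤ pointwiseTopology F) ∧
      ∀ B : Set F, IsBoundedFor 𝕜 τ B → Equicontinuous (fun f : B => (f.1.1 : Ω → 𝕜)) := by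
  obtain ⟨Y, _, _, _, _, _, _, _, δ, T, -, _, hT, hδ⟩ := h
  exact ⟨hT.exists_satisfiesBBC_satisfiesCNC, fun B => hT.equicontinuous hδ⟩

theorem mainTheorem3_general (hF : ∀ f ∈ F, Continuous f) (hτ : IsLocallyConvexHausdorff 𝕜 τ)
    (hborn : IsBornological 𝕜 τ) :
    (AdmitsContinuousStrongCompleteBarrelledLinearisation.{u, v, w} F τ ↔
      (∃ τ' : TopologicalSpace F, IsLocallyConvexHausdorff 𝕜 τ' ∧
        SatisfiesBBC 𝕜 τ τ' ∧ SatisfiesCNC 𝕜 τ τ' ∧ τ' ≤ pointwiseTopology F) ∧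
      ∀ B : Set F, IsBoundedFor 𝕜 τ B → Equicontinuous (fun f : B => (f.1.1 : Ω → 𝕜))) ∧
    (AdmitsContinuousStrongCompleteBarrelledLinearisation.{u, v, w} F τ ↔
      ∃ τ' : TopologicalSpace F, IsLocallyConvexHausdorff 𝕜 τ' ∧
        SatisfiesBBC 𝕜 τ τ' ∧ SatisfiesCNC 𝕜 τ τ' ∧ HasContinuousPointEvaluation F τ τ') ∧
    (IsGkRSpace.{u, w'} Ω →
      (∃ τ' : TopologicalSpace F, IsLocallyConvexHausdorff 𝕜 τ' ∧
        SatisfiesBBC 𝕜 τ τ' ∧ SatisfiesCNC 𝕜 τ τ' ∧ τ' ≤ compactOpenTopology F) →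
      ∃ τ' : TopologicalSpace F, IsLocallyConvexHausdorff 𝕜 τ' ∧
        SatisfiesBBC 𝕜 τ τ' ∧ SatisfiesCNC 𝕜 τ τ' ∧ HasContinuousPointEvaluation F τ τ') := by
  refine ⟨⟨fun h => h.exists_bbc_cnc, ?_⟩, ⟨fun h => ?_, ?_⟩, ?_⟩
  · rintro ⟨⟨τ', hτ', hBBC, hCNC, hle⟩, heq⟩
    exact (hasContinuousPointEvaluation_of_equicontinuous hle heq).admitsLinearisation
      hτ hborn hτ' hBBC hCNC
  · obtain ⟨⟨τ', hτ', hBBC, hCNC, hle⟩, heq⟩ := h.exists_bbc_cnc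
    exact ⟨τ', hτ', hBBC, hCNC, hasContinuousPointEvaluation_of_equicontinuous hle heq⟩
  · rintro ⟨τ', hτ', hBBC, hCNC, hδ⟩
    exact hδ.admitsLinearisation hτ hborn hτ' hBBC hCNC
  · rintro hΩ ⟨τ', hτ', hBBC, hCNC, hle⟩
    exact ⟨τ', hτ', hBBC, hCNC, hasContinuousPointEvaluation_of_equicontinuous
      (hle.trans compactOpenTopology_le_pointwiseTopology) fun B =>
        equicontinuous_of_isBoundedFor_of_isGkRSpace hΩ hF hBBC hle⟩

end FunctionSpaces

theorem mainTheorem3 {𝕜 : Type v} [RCLike 𝕜] {Ω : Type u} [TopologicalSpace Ω] [T2Space Ω]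
    [Nonempty Ω] (F : Submodule 𝕜 (Ω → 𝕜)) (hF : ∀ f ∈ F, Continuous f)
    (τ : TopologicalSpace F) (hτ : IsLocallyConvexHausdorff 𝕜 τ) (hborn : IsBornological 𝕜 τ) :
    -- (a) ⇔ (b)
    (AdmitsContinuousStrongCompleteBarrelledLinearisation.{u, v, w} F τ ↔
      (∃ τ' : TopologicalSpace F, IsLocallyConvexHausdorff 𝕜 τ' ∧
        SatisfiesBBC 𝕜 τ τ' ∧ SatisfiesCNC 𝕜 τ τ' ∧ τ' ≤ pointwiseTopology F) ∧
      ∀ B : Set F, IsBoundedFor 𝕜 τ B → Equicontinuous (fun f : B => (f.1.1 : Ω → 𝕜))) ∧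
    -- (a) ⇔ (c)
    (AdmitsContinuousStrongCompleteBarrelledLinearisation.{u, v, w} F τ ↔
      ∃ τ' : TopologicalSpace F, IsLocallyConvexHausdorff 𝕜 τ' ∧
        SatisfiesBBC 𝕜 τ τ' ∧ SatisfiesCNC 𝕜 τ τ' ∧
        ∃ hδ : ∀ x : Ω, pointEvaluation F x ∈ boundedlyContinuousDual 𝕜 τ τ',
          @Continuous Ω (boundedlyContinuousDual 𝕜 τ τ') _ (boundedlyContinuousDualTopology 𝕜 τ τ')
            (fun x => ⟨pointEvaluation F x, hδ x⟩)) ∧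
    -- (d) ⇒ (c) on `gk_ℝ`-spaces
    (IsGkRSpace.{u, w'} Ω →
      (∃ τ' : TopologicalSpace F, IsLocallyConvexHausdorff 𝕜 τ' ∧
        SatisfiesBBC 𝕜 τ τ' ∧ SatisfiesCNC 𝕜 τ τ' ∧ τ' ≤ compactOpenTopology F) →
      ∃ τ' : TopologicalSpace F, IsLocallyConvexHausdorff 𝕜 τ' ∧
        SatisfiesBBC 𝕜 τ τ' ∧ SatisfiesCNC 𝕜 τ τ' ∧
        ∃ hδ : ∀ x : Ω, pointEvaluation F x ∈ boundedlyContinuousDual 𝕜 τ τ',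
          @Continuous Ω (boundedlyContinuousDual 𝕜 τ τ') _ (boundedlyContinuousDualTopology 𝕜 τ τ')
            (fun x => ⟨pointEvaluation F x, hδ x⟩)) :=
  mainTheorem3_general hF hτ hborn
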